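/- Let $q$ be a power of an odd prime, $k=\mathbb F_q(T)$, $R=\mathbb F_q[T]$, and let $D\in R$ be a monic square-free polynomial of even degree $\deg D=2d$ that is not a square. Let $K=k(\sqrt D)$, let $\mathcal O_K$ be the integral closure of $R$ in $K$, and let $h(D)$ be the order of the ideal class group of $\mathcal O_K$. Let $\sqrt D=[a_0,a_1,a_2,\dots]$ be the simple continued fraction expansion in $\mathbb F_q((1/T))$ of the square root of $D$ with leading coefficient $1$: its complete quotients are $\alpha_0=\sqrt D$ and $\alpha_{n+1}=1/(\alpha_n-a_n)$, where $a_n\in R$ is the polynomial part of $\alpha_n$. Then there are unique $P_n,Q_n\in R$, $Q_n\neq 0$, with $\alpha_n=(\sqrt D+P_n)/Q_n$ for all $n\ge 0$ ($Q_n$ is the $n$-th complete denominator), and there is a least integer $v\ge 1$ (the quasi-period) such that, for some $c\in\mathbb F_q^\times$, one has $a_{n+v}=c\,a_n$ or $a_{n+v}=c^{-1}a_n$ for every $n\ge 1$. Let $P\in R$ be an irreducible polynomial that splits in $K$, that is, $P\mathcal O_K=\mathfrak p\,\mathfrak q$ with prime ideals $\mathfrak p\ne\mathfrak q$. Then $h(D)$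 has a divisor $h_1$, namely the order of the ideal class of any prime of $\mathcal O_K$ above $P$, such that $$h_1=\frac{\deg Q_i}{\deg P}\ \text{ for some } 1\le i\le v,\qquad\text{or}\qquad h_1\ge \frac{d}{\deg P}.$$ In particular, $$h(D)\ \ge\ \min\left(\left\{\frac{\deg Q_i}{\deg P} : 0<i<v\right\}\cup\left\{\frac{d}{\deg P}\right\}\right).$$ -/

import Mathlib

open Polynomial

noncomputable section

/-- The embedding of `F[T]` into the field of formal Laurent series in `1/T`, that is, into the
completion of `F(T)` at the infinite place.  The variable of `LaurentSeries F` plays the role of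
`1/T`, so that `T` is sent to `single (-1) 1`. -/
def polyToLaurent (F : Type*) [Field F] : F[X] →+* LaurentSeries F :=
  Polynomial.eval₂RingHom (HahnSeries.C : F →+* LaurentSeries F) (HahnSeries.single (-1) 1)

/-- The polynomial part of a Laurent series in `1/T`: the sum of its terms `c * T ^ k` with
`0 ≤ k`.  There are none with `k > |order|`. -/
def polyPart {F : Type*} [Field F] (x : LaurentSeries F) : F[X] :=
  ∑ k ∈ Finset.range (x.order.natAbs + 1), Polynomial.monomial k (x.coeff (-(k : ℤ)))

/-- The complete quotients of the (simple) continued fraction expansion of `x`: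
`α₀ = x` and `αₙ₊₁ = 1 / (αₙ - aₙ)`, where `aₙ` is the polynomial part of `αₙ`. -/
def completeQuotient {F : Type*} [Field F] (x : LaurentSeries F) : ℕ → LaurentSeries F
  | 0 => x
  | n + 1 => (completeQuotient x n - polyToLaurent F (polyPart (completeQuotient x n)))⁻¹

/-- The partial quotients `aₙ` in the continued fraction expansion `x = [a₀, a₁, a₂, …]`. -/
def partialQuotient {F : Type*} [Field F] (x : LaurentSeries F) (n : ℕ) : F[X] :=
  polyPart (completeQuotient x n)

/-- `s` is the square root of `D` with leading coefficient `1`, as a Laurent series in `1/T`. -/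
def IsMonicSqrt {F : Type*} [Field F] (D : F[X]) (s : LaurentSeries F) : Prop :=
  s ^ 2 = polyToLaurent F D ∧ s.leadingCoeff = 1

/-- `Pn` and `Qn` are the polynomials in the representation `αₙ = (s + Pₙ) / Qₙ` of the complete
quotients of `s`; `Qₙ` is the `n`-th complete denominator.  (They are uniquely determined when
`s` is not a rational function.) -/
def IsCompleteQuotientData {F : Type*} [Field F] (s : LaurentSeries F) (Pn Qn : ℕ → F[X]) : Prop :=
  ∀ n, Qn n ≠ 0 ∧
    completeQuotient s n = (s + polyToLaurent F (Pn n)) / polyToLaurent F (Qn n)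

/-- `v` is the quasi-period of the sequence `a₀, a₁, …`: the least positive integer for which
there is a nonzero constant `c` such that, for every `n ≥ 1`, `aₙ₊ᵥ` is `c aₙ` or `c⁻¹ aₙ`. -/
def IsQuasiPeriod {F : Type*} [Field F] (a : ℕ → F[X]) (v : ℕ) : Prop :=
  IsLeast {v : ℕ | 0 < v ∧ ∃ c : F, c ≠ 0 ∧
    ∀ n, 1 ≤ n → a (n + v) = C c * a n ∨ a (n + v) = C c⁻¹ * a n} v

/-- The polynomial `P` splits in the quadratic extension whose ring of integers is `O`:
the ideal `(P)` of `O` is the product of two different prime ideals. -/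
def SplitsIn {F : Type*} [Field F] (P : F[X]) (O : Type*) [CommRing O] [Algebra F[X] O] : Prop :=
  ∃ 𝔭 𝔮 : Ideal O, 𝔭.IsPrime ∧ 𝔮.IsPrime ∧ 𝔭 ≠ 𝔮 ∧
    Ideal.span {algebraMap F[X] O P} = 𝔭 * 𝔮

/-- `m` is the order of the ideal class of `𝔭`: the least positive integer for which `𝔭 ^ m` is
principal. -/
def IsClassOrder {O : Type*} [CommRing O] (𝔭 : Ideal O) (m : ℕ) : Prop :=
  IsLeast {m : ℕ | 0 < m ∧ (𝔭 ^ m).IsPrincipal} m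

/-- The ideal class number of `K` over `F(T)`: the order of the ideal class group of the integral
closure of `F[T]` in `K`. -/
def idealClassNumber (F K : Type*) [Field F] [Field K] [Algebra F[X] K] : ℕ :=
  Nat.card (ClassGroup (FunctionField.ringOfIntegers F K))

end

/-! ### Laurent series in `1/T`, degrees, and the monic square root of `D` -/

section Laurent

variable {F : Type*} [Field F]

/-! Let 𝔭 lie above P and let h₁ be the order of its class. Since D is square-free and 2 ≠ 0, the
integral closure is R[√D], so 𝔭 ^ h₁ = (p + q√D) with p, q ∈ R. Because 𝔭 ≠ 𝔮, p and q are coprime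
and p² − Dq² is a constant times P ^ h₁ (`exists_coprime_natDegree_norm`).

If h₁ deg P < d, this norm is smaller than √D. For the right sign of q that gives |p − q√D| < 1/|q|,
so p/q behaves like a convergent. A Euclidean descent along the continued fraction
(`exists_order_norm_eq`) keeps (p − qαₙ)(p − qᾱₙ)Qₙ up to sign and ends at some Q_j, whence h₁ deg P
= deg Q_j.

The relation deg aₙ + deg Qₙ = d turns quasi-periodicity of the aₙ into v-periodicity of deg Qₙ for
n ≥ 1, so j may be taken in 1, …, v. As deg Q_v = 0 and h₁ > 0, the index v never occurs; with h₁ ∣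
h(D) this gives the final bound.

Throughout, the order of a nonzero Laurent series is minus its degree in T. -/

theorem polyToLaurent_coeff_neg (p : F[X]) (k : ℕ) :
    (polyToLaurent F p).coeff (-(k : ℤ)) = p.coeff k := by
  induction p using Polynomial.induction_on' with
  | add p q hp hq => simp [hp, hq]
  | monomial n a =>
    have h : polyToLaurent F (monomial n a) = HahnSeries.single (-(n : ℤ)) a := by
      simp [polyToLaurent, HahnSeries.single_pow, HahnSeries.C_apply, HahnSeries.single_mul_single]
    rw [h, HahnSeries.coeff_single, coeff_monomial]
    simp [eq_comm]

theorem polyToLaurent_injective : Function.Injective (polyToLaurent F) := by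
  intro p q h
  ext k
  rw [← polyToLaurent_coeff_neg, ← polyToLaurent_coeff_neg, h]

@[simp]
theorem polyToLaurent_eq_zero {p : F[X]} : polyToLaurent F p = 0 ↔ p = 0 :=
  map_eq_zero_iff _ polyToLaurent_injective

theorem order_polyToLaurent (p : F[X]) : (polyToLaurent F p).order = -(p.natDegree : ℤ) := by
  by_cases hp : p = 0
  · simp [hp]
  apply le_antisymm
  · apply HahnSeries.order_le_of_coeff_ne_zero
    rw [polyToLaurent_coeff_neg]
    simpa using hp
  · rw [HahnSeries.le_order_iff_forall (by simpa using hp)]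
    intro j hj
    obtain ⟨k, rfl⟩ : ∃ k : ℕ, j = -(k : ℤ) := ⟨j.natAbs, by omega⟩
    rw [polyToLaurent_coeff_neg]
    exact coeff_eq_zero_of_natDegree_lt (by omega)

theorem polyPart_coeff (x : LaurentSeries F) (k : ℕ) :
    (polyPart x).coeff k = x.coeff (-(k : ℤ)) := by
  simp only [polyPart, finsetSum_coeff, coeff_monomial, Finset.sum_ite_eq', Finset.mem_range]
  split_ifs with h
  · rfl
  · rw [HahnSeries.coeff_eq_zero_of_lt_order]
    omega

theorem sub_polyPart_coeff (x : LaurentSeries F) {k : ℤ} (hk : k ≤ 0) :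
    (x - polyToLaurent F (polyPart x)).coeff k = 0 := by
  obtain ⟨j, rfl⟩ : ∃ j : ℕ, k = -(j : ℤ) := ⟨k.natAbs, by omega⟩
  simp [polyToLaurent_coeff_neg, polyPart_coeff]

theorem order_sub_polyPart_pos {x : LaurentSeries F} (hx : x - polyToLaurent F (polyPart x) ≠ 0) :
    0 < (x - polyToLaurent F (polyPart x)).order := by
  by_contra h
  exact hx (HahnSeries.coeff_order_eq_zero.1 (sub_polyPart_coeff x (not_lt.1 h)))

theorem natDegree_polyPart {x : LaurentSeries F} (hx : x.order < 0) :
    ((polyPart x).natDegree : ℤ) = -x.order := by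
  have hx0 : x ≠ 0 := by rintro rfl; simp at hx
  obtain ⟨k, hk⟩ : ∃ k : ℕ, x.order = -(k : ℤ) := ⟨x.order.natAbs, by omega⟩
  have : (polyPart x).natDegree = k := by
    apply natDegree_eq_of_le_of_coeff_ne_zero
    · rw [natDegree_le_iff_coeff_eq_zero]
      intro j hj
      rw [polyPart_coeff, HahnSeries.coeff_eq_zero_of_lt_order]
      omega
    · rw [polyPart_coeff, ← hk]
      exact HahnSeries.coeff_order_eq_zero.not.2 hx0
  omega

theorem eq_zero_of_order_polyToLaurent_pos {p : F[X]} {x : LaurentSeries F}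
    (hx : 0 < x.order) (h : polyToLaurent F p = x) : p = 0 := by
  have := order_polyToLaurent p
  rw [h] at this
  omega

/-- The inequality is required only for `y ≠ 0` because the zero series has order `0` by convention,
not infinity. -/
theorem order_add_of_lt {x y : LaurentSeries F} (hx : x ≠ 0) (h : y ≠ 0 → x.order < y.order) :
    x + y ≠ 0 ∧ (x + y).order = x.order := by
  by_cases hy : y = 0
  · simp [hy, hx]
  have h1 : x.orderTop < y.orderTop := by
    rw [← HahnSeries.order_eq_orderTop_of_ne_zero hx, ← HahnSeries.order_eq_orderTop_of_ne_zero hy]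
    exact_mod_cast h hy
  have h2 := HahnSeries.orderTop_add_eq_left h1
  have h3 : x + y ≠ 0 := by
    rw [← HahnSeries.orderTop_ne_top, h2]
    exact HahnSeries.orderTop_ne_top.2 hx
  refine ⟨h3, ?_⟩
  rw [← HahnSeries.order_eq_orderTop_of_ne_zero hx, ← HahnSeries.order_eq_orderTop_of_ne_zero h3] at h2
  exact_mod_cast h2

theorem order_sub_of_lt {x y : LaurentSeries F} (hx : x ≠ 0) (h : y ≠ 0 → x.order < y.order) :
    x - y ≠ 0 ∧ (x - y).order = x.order := by
  rw [sub_eq_add_neg]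
  exact order_add_of_lt hx (by simpa using h)

theorem order_inv_eq_neg (x : LaurentSeries F) : (x⁻¹).order = -x.order := by
  by_cases hx : x = 0
  · simp [hx]
  have := HahnSeries.order_mul hx (inv_ne_zero hx)
  rw [mul_inv_cancel₀ hx, HahnSeries.order_one] at this
  omega

theorem order_div_eq_sub {x y : LaurentSeries F} (hx : x ≠ 0) (hy : y ≠ 0) :
    (x / y).order = x.order - y.order := by
  rw [div_eq_mul_inv, HahnSeries.order_mul hx (inv_ne_zero hy), order_inv_eq_neg]
  ring

/-- Hensel's lemma: modulo the variable, `1` is a root of `X ^ 2 - f`, and it is simple because `2 ≠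
0`. -/
theorem exists_powerSeries_sq (h2 : (2 : F) ≠ 0) (f : PowerSeries F)
    (hf : PowerSeries.constantCoeff f = 1) :
    ∃ g : PowerSeries F, g ^ 2 = f ∧ PowerSeries.constantCoeff g = 1 := by
  have hen : HenselianRing (PowerSeries F) (Ideal.span {PowerSeries.X}) := inferInstance
  obtain ⟨g, hg, hg1⟩ := hen.is_henselian (X ^ 2 - C f) (monic_X_pow_sub_C f two_ne_zero) 1
    (by
      rw [Ideal.mem_span_singleton, PowerSeries.X_dvd_iff]
      simp [hf])
    (by
      apply IsUnit.map
      rw [PowerSeries.isUnit_iff_constantCoeff]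
      simpa [← one_add_one_eq_two] using h2)
  refine ⟨g, ?_, ?_⟩
  · simpa [IsRoot, sub_eq_zero] using hg
  · rw [Ideal.mem_span_singleton, PowerSeries.X_dvd_iff] at hg1
    simpa [sub_eq_zero] using hg1

/-- As `D` is monic, `T ^ (-2d) * D` is a power series in `1/T` with constant term `1`; its square
root is then multiplied by `T ^ d`. -/
theorem exists_isMonicSqrt (h2 : (2 : F) ≠ 0) {D : F[X]} {d : ℕ} (hmonic : D.Monic)
    (hdeg : D.natDegree = 2 * d) :
    ∃ s : LaurentSeries F, IsMonicSqrt D s ∧ s.order = -(d : ℤ) := by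
  set x : LaurentSeries F := HahnSeries.single (2 * d : ℤ) 1 * polyToLaurent F D with hx
  have hxc : ∀ k : ℤ, x.coeff k = (polyToLaurent F D).coeff (k - 2 * d) := by
    intro k
    rw [hx, HahnSeries.coeff_single_mul, one_mul]
  set f : PowerSeries F := PowerSeries.mk fun n => x.coeff n with hf
  have hfx : HahnSeries.ofPowerSeries ℤ F f = x := by
    ext k
    by_cases hk : 0 ≤ k
    · obtain ⟨n, rfl⟩ := Int.eq_ofNat_of_zero_le hk
      rw [HahnSeries.ofPowerSeries_apply_coeff]
      simp [hf]
    · rw [PowerSeries.coeff_coe, if_pos (by omega), hxc, HahnSeries.coeff_eq_zero_of_lt_order]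
      rw [order_polyToLaurent, hdeg]
      push_cast
      omega
  obtain ⟨g, hg, hg1⟩ := exists_powerSeries_sq h2 f (by
    rw [← PowerSeries.coeff_zero_eq_constantCoeff_apply, hf, PowerSeries.coeff_mk, hxc]
    have := polyToLaurent_coeff_neg D (2 * d)
    rw [← hdeg, hmonic.coeff_natDegree, hdeg] at this
    simpa using this)
  set y : LaurentSeries F := HahnSeries.ofPowerSeries ℤ F g with hy
  have hy0 : y.coeff 0 = 1 := by
    have := HahnSeries.ofPowerSeries_apply_coeff (Γ := ℤ) g 0
    simpa [hg1] using this
  have hyne : y ≠ 0 := HahnSeries.ne_zero_of_coeff_ne_zero (g := 0) (by simp [hy0])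
  have hyo : y.order = 0 := by
    apply le_antisymm
    · exact HahnSeries.order_le_of_coeff_ne_zero (by simp [hy0])
    · rw [HahnSeries.le_order_iff_forall hyne]
      intro j hj
      rw [hy, PowerSeries.coeff_coe, if_pos hj]
  have hso : (HahnSeries.single (-d : ℤ) 1 * y).order = -(d : ℤ) := by
    rw [HahnSeries.order_mul (HahnSeries.single_ne_zero one_ne_zero) hyne,
      HahnSeries.order_single one_ne_zero, hyo, add_zero]
  refine ⟨HahnSeries.single (-d : ℤ) 1 * y, ⟨?_, ?_⟩, hso⟩
  · rw [mul_pow, hy, ← map_pow (HahnSeries.ofPowerSeries ℤ F), hg, hfx, hx,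
      HahnSeries.single_pow, ← mul_assoc, HahnSeries.single_mul_single]
    simp
  · rw [HahnSeries.leadingCoeff_eq, hso, HahnSeries.coeff_single_mul]
    simp [hy0]

end Laurent

/-! ### The continued fraction of √D: complete quotients and their conjugates -/

section ContinuedFraction

variable {F : Type*} [Field F]

/-- The pairs `(Pₙ, Qₙ)` with `αₙ = (s + Pₙ) / Qₙ` for the complete quotients `αₙ` of a square root
`s` of `D`. -/
noncomputable def completeQuotientPair (D : F[X]) (s : LaurentSeries F) : ℕ → F[X] × F[X]
  | 0 => (0, 1)
  | n + 1 =>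
    let p := completeQuotientPair D s n
    let P' := partialQuotient s n * p.2 - p.1
    (P', (D - P' ^ 2) / p.2)

/-- The conjugate `(-s + Pₙ) / Qₙ` of the `n`-th complete quotient. -/
noncomputable def conjQuotient (D : F[X]) (s : LaurentSeries F) (n : ℕ) : LaurentSeries F :=
  (-s + polyToLaurent F (completeQuotientPair D s n).1) /
    polyToLaurent F (completeQuotientPair D s n).2

theorem completeQuotient_succ (s : LaurentSeries F) (n : ℕ) :
    completeQuotient s (n + 1) =
      (completeQuotient s n - polyToLaurent F (partialQuotient s n))⁻¹ := rfl

theorem sub_sq_ne_zero {D : F[X]} (hD : ¬ IsSquare D) (p : F[X]) : D - p ^ 2 ≠ 0 := by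
  intro h
  exact hD ⟨p, by rw [← sq]; exact sub_eq_zero.1 h⟩

theorem isSquare_of_mul_sq_eq {D p q : F[X]} (hq : q ≠ 0) (h : D * q ^ 2 = p ^ 2) : IsSquare D := by
  have h1 : q ∣ p := by
    rw [← UniqueFactorizationMonoid.pow_dvd_pow_iff_dvd two_ne_zero, ← h]
    exact dvd_mul_left _ _
  obtain ⟨r, rfl⟩ := h1
  refine ⟨r, mul_right_cancel₀ (pow_ne_zero 2 hq) ?_⟩
  rw [h]
  ring

variable {D : F[X]} {s : LaurentSeries F}

theorem eq_zero_of_mul_sqrt_eq (hs : s ^ 2 = polyToLaurent F D) (hD : ¬ IsSquare D) {p q : F[X]}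
    (h : polyToLaurent F q * s = polyToLaurent F p) : q = 0 := by
  by_contra hq
  refine hD (isSquare_of_mul_sq_eq hq (p := p) (polyToLaurent_injective ?_))
  rw [map_mul, map_pow, map_pow, ← hs, ← h]
  ring

/-- Stated for any square root `σ` of `D`, so that `σ = s` and `σ = -s` give the same recursion for
complete quotients and for their conjugates. -/
theorem inv_sub_eq {σ : LaurentSeries F} (hσ : σ ^ 2 = polyToLaurent F D) (hD : ¬ IsSquare D)
    {P Q a P' Q' : F[X]} (hQ : Q ≠ 0) (hP' : P' = a * Q - P) (hQ' : Q * Q' = D - P' ^ 2) :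
    ((σ + polyToLaurent F P) / polyToLaurent F Q - polyToLaurent F a)⁻¹ =
      (σ + polyToLaurent F P') / polyToLaurent F Q' := by
  have hne := sub_sq_ne_zero hD P'
  have hQ'0 : Q' ≠ 0 := by
    rintro rfl
    exact hne (by rw [← hQ', mul_zero])
  have h1 : polyToLaurent F Q * polyToLaurent F Q' = σ ^ 2 - polyToLaurent F P' ^ 2 := by
    rw [← map_mul, hQ', map_sub, map_pow, hσ]
  have h2 : polyToLaurent F P' =
      polyToLaurent F a * polyToLaurent F Q - polyToLaurent F P := by simp [hP']
  have hQL : polyToLaurent F Q ≠ 0 := by simpa using hQ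
  have hQ'L : polyToLaurent F Q' ≠ 0 := by simpa using hQ'0
  apply inv_eq_of_mul_eq_one_left
  field_simp
  rw [h2] at h1 ⊢
  linear_combination -h1

/-- The invariant `Qₙ ∣ D - Pₙ ^ 2` makes the division defining `Qₙ₊₁` exact. -/
theorem completeQuotientPair_spec (hs : s ^ 2 = polyToLaurent F D) (hD : ¬ IsSquare D) (n : ℕ) :
    (completeQuotientPair D s n).2 ≠ 0 ∧
    (completeQuotientPair D s n).2 ∣ D - (completeQuotientPair D s n).1 ^ 2 ∧
    (completeQuotientPair D s n).2 * (completeQuotientPair D s (n + 1)).2 =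
      D - (completeQuotientPair D s (n + 1)).1 ^ 2 ∧
    completeQuotient s n = (s + polyToLaurent F (completeQuotientPair D s n).1) /
      polyToLaurent F (completeQuotientPair D s n).2 := by
  have key : ∀ n, (completeQuotientPair D s n).2 ≠ 0 →
      (completeQuotientPair D s n).2 ∣ D - (completeQuotientPair D s n).1 ^ 2 →
      (completeQuotientPair D s n).2 * (completeQuotientPair D s (n + 1)).2 =
        D - (completeQuotientPair D s (n + 1)).1 ^ 2 := by
    intro n h0 h1
    have : (completeQuotientPair D s n).2 ∣ D - (completeQuotientPair D s (n + 1)).1 ^ 2 := by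
      obtain ⟨c, hc⟩ := h1
      refine ⟨c - partialQuotient s n ^ 2 * (completeQuotientPair D s n).2 +
        2 * partialQuotient s n * (completeQuotientPair D s n).1, ?_⟩
      simp only [completeQuotientPair]
      linear_combination hc
    exact EuclideanDomain.mul_div_cancel' h0 this
  induction n with
  | zero =>
    refine ⟨by simp [completeQuotientPair], by simp [completeQuotientPair], ?_, ?_⟩
    · exact key 0 (by simp [completeQuotientPair]) (by simp [completeQuotientPair])
    · simp [completeQuotientPair, completeQuotient]
  | succ n ih =>
    obtain ⟨h0, h1, h2, h3⟩ := ih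
    have h0' : (completeQuotientPair D s (n + 1)).2 ≠ 0 := by
      intro h
      rw [h, mul_zero] at h2
      exact sub_sq_ne_zero hD _ h2.symm
    have h1' : (completeQuotientPair D s (n + 1)).2 ∣
        D - (completeQuotientPair D s (n + 1)).1 ^ 2 := ⟨_, by rw [← h2, mul_comm]⟩
    refine ⟨h0', h1', key _ h0' h1', ?_⟩
    rw [completeQuotient_succ, h3]
    exact inv_sub_eq hs hD h0 rfl h2

theorem conjQuotient_succ (hs : s ^ 2 = polyToLaurent F D) (hD : ¬ IsSquare D) (n : ℕ) :
    conjQuotient D s (n + 1) =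
      (conjQuotient D s n - polyToLaurent F (partialQuotient s n))⁻¹ := by
  obtain ⟨h0, -, h2, -⟩ := completeQuotientPair_spec hs hD n
  exact (inv_sub_eq (by rw [neg_sq, hs]) hD h0 rfl h2).symm

/-- The norm of `αₙ₊₁` is `(Pₙ₊₁ ^ 2 - D) / Qₙ₊₁ ^ 2 = -Qₙ / Qₙ₊₁`. This is why each step of the
descent below changes the norm form only by a sign. -/
theorem completeQuotient_mul_conjQuotient (hs : s ^ 2 = polyToLaurent F D) (hD : ¬ IsSquare D)
    (n : ℕ) :
    completeQuotient s (n + 1) * conjQuotient D s (n + 1) *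
      polyToLaurent F (completeQuotientPair D s (n + 1)).2 =
        -polyToLaurent F (completeQuotientPair D s n).2 := by
  obtain ⟨h0, -, h2, -⟩ := completeQuotientPair_spec hs hD n
  obtain ⟨h0', -, -, h3⟩ := completeQuotientPair_spec hs hD (n + 1)
  rw [h3, conjQuotient]
  have h0L : polyToLaurent F (completeQuotientPair D s (n + 1)).2 ≠ 0 := by simpa using h0'
  have h2L := congrArg (polyToLaurent F) h2
  rw [map_mul, map_sub, map_pow, ← hs] at h2L
  field_simp
  linear_combination h2L

theorem sub_mul_completeQuotient_ne_zero (hs : s ^ 2 = polyToLaurent F D) (hD : ¬ IsSquare D)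
    (n : ℕ) (p : F[X]) {q : F[X]} (hq : q ≠ 0) :
    polyToLaurent F p - polyToLaurent F q * completeQuotient s n ≠ 0 := by
  obtain ⟨h0, -, -, h3⟩ := completeQuotientPair_spec hs hD n
  have h0L : polyToLaurent F (completeQuotientPair D s n).2 ≠ 0 := by simpa using h0
  intro h
  apply hq
  apply eq_zero_of_mul_sqrt_eq hs hD (p := p * (completeQuotientPair D s n).2 -
    q * (completeQuotientPair D s n).1)
  rw [h3] at h
  field_simp at h
  rw [map_sub, map_mul, map_mul]
  linear_combination -h

theorem completeQuotient_sub_ne_zero (hs : s ^ 2 = polyToLaurent F D) (hD : ¬ IsSquare D)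
    (n : ℕ) (a : F[X]) : completeQuotient s n - polyToLaurent F a ≠ 0 := by
  intro h
  apply sub_mul_completeQuotient_ne_zero hs hD n a one_ne_zero
  rw [map_one]
  linear_combination -h

/-- From the first one on, the complete quotients are reduced. -/
theorem completeQuotient_reduced (h2 : (2 : F) ≠ 0) (hs : s ^ 2 = polyToLaurent F D)
    (hD : ¬ IsSquare D) (hord : s.order < 0) (n : ℕ) :
    (completeQuotient s (n + 1)).order < 0 ∧ 0 < (conjQuotient D s (n + 1)).order := by
  have hα : ∀ n, (completeQuotient s (n + 1)).order < 0 := by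
    intro n
    rw [completeQuotient_succ, order_inv_eq_neg, neg_lt_zero]
    exact order_sub_polyPart_pos (completeQuotient_sub_ne_zero hs hD n _)
  refine ⟨hα n, ?_⟩
  induction n with
  | zero =>
    rw [conjQuotient_succ hs hD, order_inv_eq_neg, Left.neg_pos_iff]
    -- The conjugate of `α₀` is large. In `-s - a₀ = -2s + (s - a₀)` the term `-2s` dominates, so
    -- its inverse is small.
    have h0 : conjQuotient D s 0 = -s := by simp [conjQuotient, completeQuotientPair]
    have hs0 : s ≠ 0 := by rintro rfl; simp at hord
    have h2L : (2 : LaurentSeries F) = HahnSeries.C (2 : F) := by rw [map_ofNat]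
    have h2s : (-2 * s).order = s.order := by
      rw [neg_mul, HahnSeries.order_neg, h2L, HahnSeries.order_mul (by simpa using h2) hs0,
        HahnSeries.order_C, zero_add]
    have h2s0 : -2 * s ≠ 0 := by
      rw [neg_mul, neg_ne_zero, h2L]
      exact mul_ne_zero (by simpa using h2) hs0
    have h3 := (order_add_of_lt (y := s - polyToLaurent F (partialQuotient s 0)) h2s0
      (fun h => by
        have := order_sub_polyPart_pos h
        rw [h2s]
        exact hord.trans this)).2
    rw [h0, show -s - polyToLaurent F (partialQuotient s 0) =
      -2 * s + (s - polyToLaurent F (partialQuotient s 0)) by ring, h3, h2s]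
    exact hord
  | succ n ih =>
    rw [conjQuotient_succ hs hD, order_inv_eq_neg, Left.neg_pos_iff]
    have h1 := natDegree_polyPart (hα n)
    have h2 : (polyToLaurent F (partialQuotient s (n + 1))).order < 0 := by
      rw [order_polyToLaurent, partialQuotient]
      have := hα n
      omega
    have h0 : polyToLaurent F (partialQuotient s (n + 1)) ≠ 0 := by
      intro h
      rw [h] at h2
      simp at h2
    rw [← neg_sub, HahnSeries.order_neg, (order_sub_of_lt h0 fun _ => h2.trans ih).2]
    exact h2

theorem completeQuotient_sub_conjQuotient (hs : s ^ 2 = polyToLaurent F D) (hD : ¬ IsSquare D)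
    (n : ℕ) :
    completeQuotient s n - conjQuotient D s n =
      HahnSeries.C (2 : F) * s / polyToLaurent F (completeQuotientPair D s n).2 := by
  rw [(completeQuotientPair_spec hs hD n).2.2.2, conjQuotient, map_ofNat]
  ring

/-- The conjugate is small for positive indices, so `αₙ` has the degree of `αₙ - ᾱₙ = 2s / Qₙ`. For
`n = 0` the formula holds since `Q₀ = 1`. -/
theorem completeQuotient_order (h2 : (2 : F) ≠ 0) (hs : s ^ 2 = polyToLaurent F D)
    (hD : ¬ IsSquare D) (hord : s.order < 0) (n : ℕ) :
    (completeQuotient s n).order = s.order + (completeQuotientPair D s n).2.natDegree := by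
  cases n with
  | zero => simp [completeQuotientPair, completeQuotient]
  | succ n =>
    have hs0 : s ≠ 0 := by rintro rfl; simp at hord
    obtain ⟨h3, h4⟩ := completeQuotient_reduced h2 hs hD hord n
    have hα0 : completeQuotient s (n + 1) ≠ 0 := by intro h; rw [h] at h3; simp at h3
    rw [← (order_sub_of_lt hα0 fun _ => h3.trans h4).2, completeQuotient_sub_conjQuotient hs hD,
      order_div_eq_sub (mul_ne_zero (by simpa using h2) hs0)
        (by simpa using (completeQuotientPair_spec hs hD (n + 1)).1),
      HahnSeries.order_mul (by simpa using h2) hs0, HahnSeries.order_C, order_polyToLaurent]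
    ring

theorem completeQuotient_order_neg (h2 : (2 : F) ≠ 0) (hs : s ^ 2 = polyToLaurent F D)
    (hD : ¬ IsSquare D) (hord : s.order < 0) (n : ℕ) : (completeQuotient s n).order < 0 := by
  cases n with
  | zero => exact hord
  | succ n => exact (completeQuotient_reduced h2 hs hD hord n).1

theorem natDegree_partialQuotient (h2 : (2 : F) ≠ 0) (hs : s ^ 2 = polyToLaurent F D)
    (hD : ¬ IsSquare D) (hord : s.order < 0) (n : ℕ) :
    ((partialQuotient s n).natDegree + (completeQuotientPair D s n).2.natDegree : ℤ) =
      -s.order := by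
  rw [partialQuotient, natDegree_polyPart (completeQuotient_order_neg h2 hs hD hord n),
    completeQuotient_order h2 hs hD hord]
  ring

/-- Follows from `2P = Q(α + ᾱ)`, where `α` dominates. It bounds the `Pₙ` for the pigeonhole
argument. -/
theorem natDegree_completeQuotientPair_fst (h2 : (2 : F) ≠ 0) (hs : s ^ 2 = polyToLaurent F D)
    (hD : ¬ IsSquare D) (hord : s.order < 0) (n : ℕ) :
    ((completeQuotientPair D s (n + 1)).1.natDegree : ℤ) = -s.order := by
  have hs0 : s ≠ 0 := by rintro rfl; simp at hord
  obtain ⟨h3, h4⟩ := completeQuotient_reduced h2 hs hD hord n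
  have hα0 : completeQuotient s (n + 1) ≠ 0 := by intro h; rw [h] at h3; simp at h3
  have hQ := (completeQuotientPair_spec hs hD (n + 1)).1
  have hQL : polyToLaurent F (completeQuotientPair D s (n + 1)).2 ≠ 0 := by simpa using hQ
  have key : HahnSeries.C (2 : F) * polyToLaurent F (completeQuotientPair D s (n + 1)).1 =
      polyToLaurent F (completeQuotientPair D s (n + 1)).2 *
        (completeQuotient s (n + 1) + conjQuotient D s (n + 1)) := by
    rw [(completeQuotientPair_spec hs hD (n + 1)).2.2.2, conjQuotient, map_ofNat]
    field_simp
    ring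
  obtain ⟨h5, h6⟩ := order_add_of_lt hα0 fun _ => h3.trans h4
  have hP0 : polyToLaurent F (completeQuotientPair D s (n + 1)).1 ≠ 0 := by
    intro h
    rw [h, mul_zero] at key
    exact mul_ne_zero hQL h5 key.symm
  have := congrArg HahnSeries.order key
  rw [HahnSeries.order_mul (by simpa using h2) hP0, HahnSeries.order_mul hQL h5, h6,
    HahnSeries.order_C, order_polyToLaurent, order_polyToLaurent,
    completeQuotient_order h2 hs hD hord] at this
  omega

/-- A complete quotient determines the preceding reduced one. -/
theorem completeQuotient_backward (h2 : (2 : F) ≠ 0) (hs : s ^ 2 = polyToLaurent F D)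
    (hD : ¬ IsSquare D) (hord : s.order < 0) {m n : ℕ}
    (h : completeQuotient s (m + 2) = completeQuotient s (n + 2))
    (h' : conjQuotient D s (m + 2) = conjQuotient D s (n + 2)) :
    completeQuotient s (m + 1) = completeQuotient s (n + 1) ∧
      conjQuotient D s (m + 1) = conjQuotient D s (n + 1) := by
  rw [completeQuotient_succ, completeQuotient_succ s (n + 1), inv_inj] at h
  rw [conjQuotient_succ hs hD, conjQuotient_succ hs hD (n + 1), inv_inj] at h'
  have hm := (completeQuotient_reduced h2 hs hD hord m).2
  have hn := (completeQuotient_reduced h2 hs hD hord n).2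
  -- Going backwards, the conjugates determine the partial quotient: two of them differ by a
  -- polynomial but both have positive order, so that polynomial is zero.
  have key : partialQuotient s (m + 1) = partialQuotient s (n + 1) := by
    rw [← sub_eq_zero]
    have e : polyToLaurent F (partialQuotient s (m + 1) - partialQuotient s (n + 1)) =
        conjQuotient D s (m + 1) - conjQuotient D s (n + 1) := by
      rw [map_sub]
      linear_combination -h'
    by_cases h0 : conjQuotient D s (m + 1) - conjQuotient D s (n + 1) = 0
    · rwa [h0, polyToLaurent_eq_zero] at e
    · refine eq_zero_of_order_polyToLaurent_pos ?_ e
      rw [sub_eq_add_neg] at h0 ⊢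
      have := HahnSeries.min_order_le_order_add h0
      rw [HahnSeries.order_neg] at this
      exact lt_of_lt_of_le (lt_min hm hn) this
  rw [key] at h h'
  exact ⟨sub_left_inj.1 h, sub_left_inj.1 h'⟩

/-! ### Periodicity and quasi-periodicity -/

theorem finite_natDegree_le [Finite F] (n : ℕ) : {p : F[X] | p.natDegree ≤ n}.Finite := by
  have : Finite (degreeLT F (n + 1)) := Finite.of_equiv _ (degreeLTEquiv F (n + 1)).symm.toEquiv
  refine (Set.toFinite (degreeLT F (n + 1) : Set F[X])).subset fun p hp => ?_
  rw [SetLike.mem_coe, mem_degreeLT, degree_lt_iff_coeff_zero]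
  exact fun m hm => coeff_eq_zero_of_natDegree_lt (lt_of_le_of_lt hp hm)

/-- Over a finite field the pairs `(Pₙ, Qₙ)` have bounded degree, so two coincide; reducedness
carries the coincidence back to index `1`. -/
theorem exists_completeQuotient_periodic [Finite F] (h2 : (2 : F) ≠ 0)
    (hs : s ^ 2 = polyToLaurent F D) (hD : ¬ IsSquare D) (hord : s.order < 0) :
    ∃ N, 0 < N ∧ completeQuotient s (N + 1) = completeQuotient s 1 := by
  obtain ⟨d, hd⟩ : ∃ d : ℕ, s.order = -(d : ℤ) := ⟨s.order.natAbs, by omega⟩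
  have hfin : ({p : F[X] | p.natDegree ≤ d} ×ˢ {p : F[X] | p.natDegree ≤ d}).Finite :=
    (finite_natDegree_le d).prod (finite_natDegree_le d)
  have hmaps : ∀ n : ℕ, completeQuotientPair D s (n + 1) ∈
      ({p : F[X] | p.natDegree ≤ d} ×ˢ {p : F[X] | p.natDegree ≤ d}) := by
    intro n
    have h3 := natDegree_completeQuotientPair_fst h2 hs hD hord n
    have h4 := natDegree_partialQuotient h2 hs hD hord (n + 1)
    constructor
    · simp only [Set.mem_ofPred_eq]
      omega
    · simp only [Set.mem_ofPred_eq]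
      omega
  have : ∃ m n, m < n ∧ completeQuotientPair D s (m + 1) = completeQuotientPair D s (n + 1) := by
    obtain ⟨m, -, n, -, hmn, h⟩ := Set.infinite_univ.exists_lt_map_eq_of_mapsTo
      (f := fun n => completeQuotientPair D s (n + 1)) (fun n _ => hmaps n) hfin
    exact ⟨m, n, hmn, h⟩
  obtain ⟨m, n, hmn, h⟩ := this
  have back : ∀ m k : ℕ, completeQuotient s (m + k + 1) = completeQuotient s (m + 1) →
      conjQuotient D s (m + k + 1) = conjQuotient D s (m + 1) →
      completeQuotient s (k + 1) = completeQuotient s 1 := by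
    intro m k
    induction m with
    | zero => simp only [zero_add]; exact fun h _ => h
    | succ m ih =>
      intro h h'
      rw [show m + 1 + k + 1 = m + k + 2 by ring] at h h'
      obtain ⟨e, e'⟩ := completeQuotient_backward h2 hs hD hord h h'
      exact ih e e'
  refine ⟨n - m, by omega, back m _ ?_ ?_⟩
  · rw [show m + (n - m) + 1 = n + 1 by omega, (completeQuotientPair_spec hs hD (n + 1)).2.2.2,
      (completeQuotientPair_spec hs hD (m + 1)).2.2.2, h]
  · rw [show m + (n - m) + 1 = n + 1 by omega, conjQuotient, conjQuotient, h]

theorem completeQuotient_add_of_eq {x : LaurentSeries F} {m n : ℕ}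
    (h : completeQuotient x m = completeQuotient x n) (k : ℕ) :
    completeQuotient x (m + k) = completeQuotient x (n + k) := by
  induction k with
  | zero => exact h
  | succ k ih => rw [← add_assoc, ← add_assoc, completeQuotient_succ, completeQuotient_succ,
      partialQuotient, partialQuotient, ih]

theorem exists_partialQuotient_periodic [Finite F] (h2 : (2 : F) ≠ 0)
    (hs : s ^ 2 = polyToLaurent F D) (hD : ¬ IsSquare D) (hord : s.order < 0) :
    ∃ N, 0 < N ∧ (∀ n, 1 ≤ n → partialQuotient s (n + N) = partialQuotient s n) ∧
      (completeQuotientPair D s N).2.natDegree = 0 := by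
  obtain ⟨N, hN, h⟩ := exists_completeQuotient_periodic h2 hs hD hord
  refine ⟨N, hN, fun n hn => ?_, ?_⟩
  · obtain ⟨k, rfl⟩ := Nat.exists_eq_add_of_le hn
    rw [partialQuotient, partialQuotient, ← completeQuotient_add_of_eq h k,
      show 1 + k + N = N + 1 + k by ring]
  · rw [completeQuotient_succ, completeQuotient_succ s 0, inv_inj,
      (completeQuotientPair_spec hs hD N).2.2.2] at h
    have hQ := (completeQuotientPair_spec hs hD N).1
    have hQL : polyToLaurent F (completeQuotientPair D s N).2 ≠ 0 := by simpa using hQ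
    -- `α_N - a_N = s - a₀`; comparing coefficients of the irrational `s` gives `Q_N = 1`.
    have := eq_zero_of_mul_sqrt_eq hs hD (q := (completeQuotientPair D s N).2 - 1)
      (p := (completeQuotientPair D s N).1 +
        (partialQuotient s 0 - partialQuotient s N) * (completeQuotientPair D s N).2) (by
        rw [completeQuotient] at h
        field_simp at h
        simp only [map_sub, map_add, map_mul, map_one]
        linear_combination -h)
    rw [sub_eq_zero.1 this, natDegree_one]

theorem exists_isQuasiPeriod [Finite F] (h2 : (2 : F) ≠ 0)
    (hs : s ^ 2 = polyToLaurent F D) (hD : ¬ IsSquare D) (hord : s.order < 0) :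
    ∃ v, IsQuasiPeriod (partialQuotient s) v := by
  classical
  obtain ⟨N, hN, h, -⟩ := exists_partialQuotient_periodic h2 hs hD hord
  have hne : ∃ v, 0 < v ∧ ∃ c : F, c ≠ 0 ∧ ∀ n, 1 ≤ n →
      partialQuotient s (n + v) = C c * partialQuotient s n ∨
        partialQuotient s (n + v) = C c⁻¹ * partialQuotient s n :=
    ⟨N, hN, 1, one_ne_zero, fun n hn => by simp [h n hn]⟩
  exact ⟨Nat.find hne, Nat.find_spec hne, fun m hm => Nat.find_min' hne hm⟩

theorem IsQuasiPeriod.natDegree_add_mul {a : ℕ → F[X]} {v : ℕ} (hv : IsQuasiPeriod a v) {n : ℕ}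
    (hn : 1 ≤ n) (k : ℕ) : (a (n + k * v)).natDegree = (a n).natDegree := by
  obtain ⟨c, hc, h⟩ := hv.1.2
  induction k with
  | zero => simp
  | succ k ih =>
    rw [← ih, show n + (k + 1) * v = n + k * v + v by ring]
    rcases h (n + k * v) (by omega) with h | h
    · rw [h, natDegree_C_mul hc]
    · rw [h, natDegree_C_mul (inv_ne_zero hc)]

theorem natDegree_snd_eq_of_partialQuotient (h2 : (2 : F) ≠ 0)
    (hs : s ^ 2 = polyToLaurent F D) (hD : ¬ IsSquare D) (hord : s.order < 0) {m n : ℕ}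
    (h : (partialQuotient s m).natDegree = (partialQuotient s n).natDegree) :
    (completeQuotientPair D s m).2.natDegree = (completeQuotientPair D s n).2.natDegree := by
  have h3 := natDegree_partialQuotient h2 hs hD hord m
  have h4 := natDegree_partialQuotient h2 hs hD hord n
  omega

theorem IsQuasiPeriod.exists_natDegree_snd_eq (h2 : (2 : F) ≠ 0)
    (hs : s ^ 2 = polyToLaurent F D) (hD : ¬ IsSquare D) (hord : s.order < 0) {v : ℕ}
    (hv : IsQuasiPeriod (partialQuotient s) v) {n : ℕ} (hn : 1 ≤ n) :
    ∃ i, 1 ≤ i ∧ i ≤ v ∧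
      (completeQuotientPair D s i).2.natDegree = (completeQuotientPair D s n).2.natDegree := by
  have hv0 := hv.1.1
  -- The representative of `n` modulo `v` is taken in `1, …, v`, since the quasi-period relation
  -- starts at index `1`.
  refine ⟨(n - 1) % v + 1, by omega, Nat.mod_lt _ hv0, ?_⟩
  apply natDegree_snd_eq_of_partialQuotient h2 hs hD hord
  rw [← hv.natDegree_add_mul (by omega) ((n - 1) / v)]
  congr 2
  have := Nat.mod_add_div (n - 1) v
  rw [mul_comm] at this
  omega

/-- With `N` a true period, the index `N * v` is reached from `v` by steps of `v` and from `N` by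
steps of `N`; hence `deg Q_v = deg Q_N = 0`. -/
theorem IsQuasiPeriod.natDegree_snd_eq_zero [Finite F] (h2 : (2 : F) ≠ 0)
    (hs : s ^ 2 = polyToLaurent F D) (hD : ¬ IsSquare D) (hord : s.order < 0) {v : ℕ}
    (hv : IsQuasiPeriod (partialQuotient s) v) :
    (completeQuotientPair D s v).2.natDegree = 0 := by
  obtain ⟨N, hN, h, h0⟩ := exists_partialQuotient_periodic h2 hs hD hord
  rw [← h0]
  apply natDegree_snd_eq_of_partialQuotient h2 hs hD hord
  have hv0 : 1 ≤ v := hv.1.1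
  have h3 : ∀ k, partialQuotient s (N + k * N) = partialQuotient s N := by
    intro k
    induction k with
    | zero => simp
    | succ k ih =>
      rw [← ih, show N + (k + 1) * N = N + k * N + N by ring, h _ (by omega)]
  rw [← hv.natDegree_add_mul hv0 (N - 1), ← h3 (v - 1)]
  congr 2
  obtain ⟨N, rfl⟩ := Nat.exists_eq_add_of_le hN
  obtain ⟨v, rfl⟩ := Nat.exists_eq_add_of_le hv0
  simp
  ring

/-! ### Good approximations and norms of small degree -/

/-- If `p / q` in lowest terms approximates the complete quotient `αₙ` well, then the norm
of `p - q αₙ` has the same degree as a later complete denominator. -/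
theorem exists_order_norm_eq (h2 : (2 : F) ≠ 0) (hs : s ^ 2 = polyToLaurent F D)
    (hD : ¬ IsSquare D) (hord : s.order < 0) (n : ℕ) (p q : F[X]) (hpq : IsCoprime p q)
    (hq : q ≠ 0)
    (happ : (q.natDegree : ℤ) <
      (polyToLaurent F p - polyToLaurent F q * completeQuotient s n).order) :
    ∃ i, 1 ≤ i ∧ ((polyToLaurent F p - polyToLaurent F q * completeQuotient s n) *
      (polyToLaurent F p - polyToLaurent F q * conjQuotient D s n) *
        polyToLaurent F (completeQuotientPair D s n).2).order =
          -((completeQuotientPair D s i).2.natDegree : ℤ) := by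
  induction hk : q.natDegree using Nat.strong_induction_on generalizing n p q with
  | _ k ih =>
  subst hk
  set a := partialQuotient s n with ha
  -- Euclidean step: `(p, q)` at index `n` becomes `(q, r)` at index `n + 1`; both linear forms get
  -- multiplied by minus the next quotient.
  set r := p - q * a with hr
  have hα := completeQuotient_sub_ne_zero hs hD n a
  have hα' : conjQuotient D s n - polyToLaurent F a ≠ 0 := by
    intro h
    have h1 := completeQuotient_mul_conjQuotient hs hD n
    rw [conjQuotient_succ hs hD, ← ha, h, inv_zero, mul_zero, zero_mul, eq_comm, neg_eq_zero] at h1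
    exact (completeQuotientPair_spec hs hD n).1 (by simpa using h1)
  have e1 : polyToLaurent F q - polyToLaurent F r * completeQuotient s (n + 1) =
      -(polyToLaurent F p - polyToLaurent F q * completeQuotient s n) *
        completeQuotient s (n + 1) := by
    rw [completeQuotient_succ, ← ha, hr, map_sub, map_mul]
    field_simp
    ring
  have e2 : polyToLaurent F q - polyToLaurent F r * conjQuotient D s (n + 1) =
      -(polyToLaurent F p - polyToLaurent F q * conjQuotient D s n) *
        conjQuotient D s (n + 1) := by
    rw [conjQuotient_succ hs hD, ← ha, hr, map_sub, map_mul]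
    field_simp
    ring
  have e3 : (polyToLaurent F p - polyToLaurent F q * completeQuotient s n) *
      (polyToLaurent F p - polyToLaurent F q * conjQuotient D s n) *
        polyToLaurent F (completeQuotientPair D s n).2 =
      -((polyToLaurent F q - polyToLaurent F r * completeQuotient s (n + 1)) *
      (polyToLaurent F q - polyToLaurent F r * conjQuotient D s (n + 1)) *
        polyToLaurent F (completeQuotientPair D s (n + 1)).2) := by
    rw [e1, e2]
    linear_combination
      (polyToLaurent F p - polyToLaurent F q * completeQuotient s n) *
      (polyToLaurent F p - polyToLaurent F q * conjQuotient D s n) *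
      completeQuotient_mul_conjQuotient hs hD n
  rw [e3, HahnSeries.order_neg]
  by_cases hr0 : r = 0
  · refine ⟨n + 1, by omega, ?_⟩
    -- The descent stops here: `q` divides `p`, so it is a unit, and the form reduces to `q ^ 2 *
    -- Qₙ₊₁`.
    have hqu : IsUnit q := by
      have : q ∣ p := ⟨a, sub_eq_zero.1 hr0⟩
      exact hpq.isUnit_of_dvd' this dvd_rfl
    have hq0 : q.natDegree = 0 := natDegree_eq_zero_of_isUnit hqu
    have hqL : polyToLaurent F q ≠ 0 := by simpa using hq
    have hQL : polyToLaurent F (completeQuotientPair D s (n + 1)).2 ≠ 0 := by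
      simpa using (completeQuotientPair_spec hs hD (n + 1)).1
    rw [hr0, map_zero, zero_mul, zero_mul, sub_zero,
      HahnSeries.order_mul (mul_ne_zero hqL hqL) hQL, HahnSeries.order_mul hqL hqL,
      order_polyToLaurent, order_polyToLaurent, hq0]
    simp
  · have hqL : polyToLaurent F q ≠ 0 := by simpa using hq
    have hrL : polyToLaurent F r ≠ 0 := by simpa using hr0
    have h3 := sub_mul_completeQuotient_ne_zero hs hD n p hq
    have hred := (completeQuotient_reduced h2 hs hD hord n).1
    have hne : completeQuotient s (n + 1) ≠ 0 := by intro h; rw [h] at hred; simp at hred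
    -- The linear form is negligible against `r`, so `deg r = deg q - deg αₙ₊₁ < deg q`. The order
    -- of the form drops by the same amount, which preserves the approximation hypothesis.
    have e4 : polyToLaurent F q * (completeQuotient s (n + 1))⁻¹ = polyToLaurent F r -
        (polyToLaurent F p - polyToLaurent F q * completeQuotient s n) := by
      rw [completeQuotient_succ, inv_inv, ← ha, hr, map_sub, map_mul]
      ring
    have e5 : (polyToLaurent F q * (completeQuotient s (n + 1))⁻¹).order =
        (polyToLaurent F r).order := by
      rw [e4]
      refine (order_sub_of_lt hrL fun _ => ?_).2
      rw [order_polyToLaurent]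
      omega
    rw [HahnSeries.order_mul hqL (inv_ne_zero hne), order_inv_eq_neg, order_polyToLaurent,
      order_polyToLaurent] at e5
    refine ih r.natDegree (by omega) (n + 1) q r ?_ hr0 ?_ rfl
    · rw [hr]
      have := (IsCoprime.add_mul_left_right_iff (x := q) (y := p) (z := -a)).2 hpq.symm
      rwa [mul_neg, ← sub_eq_add_neg] at this
    · rw [e1, HahnSeries.order_mul (neg_ne_zero.2 h3) hne, HahnSeries.order_neg]
      omega

/-- Primitive elements `p + q √D` of small norm have the norm degree of a complete denominator. -/
theorem exists_natDegree_norm_eq (h2 : (2 : F) ≠ 0) (hs : s ^ 2 = polyToLaurent F D)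
    (hD : ¬ IsSquare D) (hord : s.order < 0) {p q : F[X]} (hpq : IsCoprime p q) (hq : q ≠ 0)
    (hsmall : ((p ^ 2 - D * q ^ 2).natDegree : ℤ) < -s.order) :
    ∃ i, 1 ≤ i ∧
      (p ^ 2 - D * q ^ 2).natDegree = (completeQuotientPair D s i).2.natDegree := by
  have hs0 : s ≠ 0 := by rintro rfl; simp at hord
  -- When `p + qs` is at least as large as `qs`, dividing the small norm by it makes `p - qs`
  -- smaller than `1 / q`.
  have hmain : ∀ q : F[X], IsCoprime p q → q ≠ 0 →
      ((p ^ 2 - D * q ^ 2).natDegree : ℤ) < -s.order →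
      (polyToLaurent F p + polyToLaurent F q * s).order ≤ (polyToLaurent F q * s).order →
      ∃ i, 1 ≤ i ∧
        (p ^ 2 - D * q ^ 2).natDegree = (completeQuotientPair D s i).2.natDegree := by
    intro q hpq hq hsmall hle
    have hqL : polyToLaurent F q ≠ 0 := by simpa using hq
    have hc : conjQuotient D s 0 = -s := by simp [conjQuotient, completeQuotientPair]
    have hQ : (completeQuotientPair D s 0).2 = 1 := rfl
    have e : (polyToLaurent F p - polyToLaurent F q * completeQuotient s 0) *
        (polyToLaurent F p - polyToLaurent F q * conjQuotient D s 0) *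
          polyToLaurent F (completeQuotientPair D s 0).2 =
        polyToLaurent F (p ^ 2 - D * q ^ 2) := by
      rw [hc, hQ, completeQuotient, map_sub, map_mul, map_pow, map_pow, map_one, ← hs]
      ring
    have e' : (polyToLaurent F p - polyToLaurent F q * s) *
        (polyToLaurent F p + polyToLaurent F q * s) = polyToLaurent F (p ^ 2 - D * q ^ 2) := by
      rw [map_sub, map_mul, map_pow, map_pow, ← hs]
      ring
    have hne1 : polyToLaurent F p - polyToLaurent F q * s ≠ 0 :=
      sub_mul_completeQuotient_ne_zero hs hD 0 p hq
    have hne2 : polyToLaurent F p + polyToLaurent F q * s ≠ 0 := by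
      have := sub_mul_completeQuotient_ne_zero hs hD 0 p (neg_ne_zero.2 hq)
      rwa [map_neg, neg_mul, sub_neg_eq_add] at this
    have ho := congrArg HahnSeries.order e'
    rw [HahnSeries.order_mul hne1 hne2, order_polyToLaurent] at ho
    rw [HahnSeries.order_mul hqL hs0, order_polyToLaurent] at hle
    obtain ⟨i, hi, h⟩ := exists_order_norm_eq h2 hs hD hord 0 p q hpq hq (by
      rw [completeQuotient]
      omega)
    refine ⟨i, hi, ?_⟩
    rw [e, order_polyToLaurent] at h
    omega
  by_cases hle : (polyToLaurent F p + polyToLaurent F q * s).order ≤ (polyToLaurent F q * s).order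
  · exact hmain q hpq hq hsmall hle
  · have hqL : polyToLaurent F q ≠ 0 := by simpa using hq
    -- Otherwise `p - qs = -2qs + (p + qs)` is as large as `qs`, and changing the sign of `q` keeps
    -- the norm.
    have := hmain (-q) hpq.neg_right (neg_ne_zero.2 hq) (by rwa [neg_sq]) (by
      rw [map_neg, neg_mul, HahnSeries.order_neg]
      have h2L : (2 : LaurentSeries F) = HahnSeries.C (2 : F) := by rw [map_ofNat]
      have hne : -2 * (polyToLaurent F q * s) ≠ 0 := by
        rw [neg_mul, neg_ne_zero, h2L]
        exact mul_ne_zero (by simpa using h2) (mul_ne_zero hqL hs0)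
      have ho : (-2 * (polyToLaurent F q * s)).order = (polyToLaurent F q * s).order := by
        rw [neg_mul, HahnSeries.order_neg, h2L, HahnSeries.order_mul (by simpa using h2)
          (mul_ne_zero hqL hs0), HahnSeries.order_C, zero_add]
      have h3 := (order_add_of_lt (y := polyToLaurent F p + polyToLaurent F q * s) hne
        fun _ => by rw [ho]; exact not_le.1 hle).2
      rw [show polyToLaurent F p + -(polyToLaurent F q * s) = -2 * (polyToLaurent F q * s) +
        (polyToLaurent F p + polyToLaurent F q * s) by ring, h3, ho])
    rwa [neg_sq] at this

end ContinuedFraction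

/-! ### Generators of powers of a split prime -/

section QuadraticOrder

variable {F : Type*} [Field F]

theorem natDegree_eq_of_associated {p q : F[X]} (h : Associated p q) :
    p.natDegree = q.natDegree :=
  natDegree_eq_natDegree (degree_eq_degree_of_associated h)

theorem IsPrime.eq_of_mul_le {O : Type*} [CommRing O] [IsDedekindDomain O] {𝔭 𝔮 𝔯 : Ideal O}
    (h𝔭 : 𝔭.IsPrime) (h𝔮 : 𝔮.IsPrime) (h𝔯 : 𝔯.IsPrime) (h𝔭0 : 𝔭 ≠ ⊥) (h𝔮0 : 𝔮 ≠ ⊥)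
    (hle : 𝔭 * 𝔮 ≤ 𝔯) : 𝔯 = 𝔭 ∨ 𝔯 = 𝔮 := by
  rcases (h𝔯.mul_le).1 hle with h | h
  · exact Or.inl ((h𝔭.isMaximal h𝔭0).eq_of_le h𝔯.ne_top h).symm
  · exact Or.inr ((h𝔮.isMaximal h𝔮0).eq_of_le h𝔯.ne_top h).symm

variable {O : Type*} [CommRing O] [IsDedekindDomain O] [Algebra F[X] O]

theorem le_of_dvd_pow_of_span_eq {P : F[X]} {𝔭 𝔮 : Ideal O}
    (h𝔭 : 𝔭.IsPrime) (h𝔮 : 𝔮.IsPrime) (h𝔭0 : 𝔭 ≠ ⊥) (h𝔮0 : 𝔮 ≠ ⊥) (hne : 𝔭 ≠ 𝔮)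
    (hsplit : Ideal.span {algebraMap F[X] O P} = 𝔭 * 𝔮) {x : O} {h j : ℕ}
    (hx : 𝔭 ^ h = Ideal.span {x}) (hdvd : x ∣ algebraMap F[X] O P ^ j) : h ≤ j := by
  have hp := Ideal.prime_of_isPrime h𝔭0 h𝔭
  have hq := Ideal.prime_of_isPrime h𝔮0 h𝔮
  have h1 : 𝔭 ^ h ∣ 𝔭 ^ j * 𝔮 ^ j := by
    rw [hx, ← mul_pow, ← hsplit, Ideal.span_singleton_pow, Ideal.dvd_iff_le,
      Ideal.span_singleton_le_span_singleton]
    exact hdvd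
  have h2 : ¬ 𝔭 ∣ 𝔮 ^ j := fun h =>
    hne (associated_iff_eq.1 (hp.associated_of_dvd hq (hp.dvd_of_dvd_pow h)))
  exact (pow_dvd_pow_iff h𝔭0 hp.not_isUnit).1 (hp.pow_dvd_of_dvd_mul_right h h2 h1)

/-- A generator of the principal ideal `𝔭 ^ h` in the order `F[T][√D]`, where `𝔭` lies above the
split prime `P`, is primitive and of norm `c * P ^ h`. -/
theorem exists_coprime_natDegree_norm (hinj : Function.Injective (algebraMap F[X] O)) {D : F[X]}
    {Θ : O} (hΘ : Θ ^ 2 = algebraMap F[X] O D)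
    (hspan : ∀ x : O, ∃ p q : F[X], x = algebraMap F[X] O p + algebraMap F[X] O q * Θ)
    (hind : ∀ p q : F[X], algebraMap F[X] O p + algebraMap F[X] O q * Θ = 0 → q = 0)
    {P : F[X]} (hP : Irreducible P) {𝔭 𝔮 : Ideal O}
    (h𝔭 : 𝔭.IsPrime) (h𝔮 : 𝔮.IsPrime) (hne : 𝔭 ≠ 𝔮)
    (hsplit : Ideal.span {algebraMap F[X] O P} = 𝔭 * 𝔮) {h : ℕ} (hh : 0 < h)
    (hprin : (𝔭 ^ h).IsPrincipal) :
    ∃ p q : F[X], IsCoprime p q ∧ q ≠ 0 ∧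
      (p ^ 2 - D * q ^ 2).natDegree = h * P.natDegree := by
  have hP0 : algebraMap F[X] O P ≠ 0 := by
    rw [Ne, map_eq_zero_iff _ hinj]
    exact hP.ne_zero
  have hmul0 : 𝔭 * 𝔮 ≠ ⊥ := by
    rw [← hsplit, Ne, Ideal.span_singleton_eq_bot]
    exact hP0
  have h𝔭0 : 𝔭 ≠ ⊥ := by rintro rfl; simp at hmul0
  have h𝔮0 : 𝔮 ≠ ⊥ := by rintro rfl; simp at hmul0
  have hpos : 0 < P.natDegree := hP.natDegree_pos
  obtain ⟨x, hx⟩ := hprin.principal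
  rw [Ideal.submodule_span_eq] at hx
  have hx0 : x ≠ 0 := by
    rintro rfl
    rw [Ideal.span_singleton_eq_bot.2 rfl] at hx
    exact pow_ne_zero h h𝔭0 hx
  have hxP : x ∣ algebraMap F[X] O P ^ h := by
    rw [← Ideal.span_singleton_le_span_singleton (α := O), ← hx, ← Ideal.span_singleton_pow,
      hsplit, mul_pow]
    exact Ideal.mul_le_left
  obtain ⟨y, hy⟩ := hxP
  -- The cofactor `y = P ^ h / x` plays the role of the conjugate: it generates `𝔮 ^ h`.
  have hyq : 𝔮 ^ h = Ideal.span {y} := by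
    apply mul_left_cancel₀ (pow_ne_zero h h𝔭0)
    rw [← mul_pow, ← hsplit, Ideal.span_singleton_pow, hy, ← Ideal.span_singleton_mul_span_singleton,
      ← hx]
  obtain ⟨p, q, hpq⟩ := hspan x
  obtain ⟨p', q', hpq'⟩ := hspan y
  have hNx : algebraMap F[X] O (p ^ 2 - D * q ^ 2) =
      x * (algebraMap F[X] O p - algebraMap F[X] O q * Θ) := by
    rw [hpq, map_sub, map_mul, map_pow, map_pow, ← hΘ]
    ring
  have hNy : algebraMap F[X] O (p' ^ 2 - D * q' ^ 2) =
      y * (algebraMap F[X] O p' - algebraMap F[X] O q' * Θ) := by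
    rw [hpq', map_sub, map_mul, map_pow, map_pow, ← hΘ]
    ring
  have hxy : algebraMap F[X] O (p * p' + D * q * q' - P ^ h) +
      algebraMap F[X] O (p * q' + p' * q) * Θ = 0 := by
    simp only [map_add, map_sub, map_mul, map_pow, ← hΘ, hy, hpq, hpq']
    ring
  have h2 := hind _ _ hxy
  have h1 : p * p' + D * q * q' - P ^ h = 0 := by
    rwa [h2, map_zero, zero_mul, add_zero, map_eq_zero_iff _ hinj] at hxy
  -- Brahmagupta's identity, with `pp' + Dqq' = P ^ h` and `pq' + p'q = 0` read off from `x * y = P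
  -- ^ h`.
  have hNN : (p ^ 2 - D * q ^ 2) * (p' ^ 2 - D * q' ^ 2) = P ^ (2 * h) := by
    rw [mul_comm 2 h, pow_mul]
    linear_combination (p * p' + D * q * q' + P ^ h) * h1 - D * (p * q' + p' * q) * h2
  obtain ⟨i, -, hi⟩ := (dvd_prime_pow hP.prime _).1 (Dvd.intro _ hNN)
  obtain ⟨j, -, hj⟩ := (dvd_prime_pow hP.prime _).1 (Dvd.intro_left _ hNN)
  have hij : i + j = 2 * h := by
    have := natDegree_eq_of_associated (hi.mul_mul hj)
    rw [hNN, ← pow_add, natDegree_pow, natDegree_pow] at this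
    exact (Nat.eq_of_mul_eq_mul_right hpos this).symm
  -- Both norms have `P`-exponent at least `h` and the exponents add up to `2h`, so each equals `h`.
  have hxi : h ≤ i := by
    refine le_of_dvd_pow_of_span_eq h𝔭 h𝔮 h𝔭0 h𝔮0 hne hsplit hx ?_
    rw [← map_pow]
    exact (Dvd.intro _ hNx.symm).trans ((algebraMap F[X] O).map_dvd hi.dvd)
  have hyj : h ≤ j := by
    refine le_of_dvd_pow_of_span_eq h𝔮 h𝔭 h𝔮0 h𝔭0 hne.symm (hsplit.trans (mul_comm _ _)) hyq ?_
    rw [← map_pow]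
    exact (Dvd.intro _ hNy.symm).trans ((algebraMap F[X] O).map_dvd hj.dvd)
  obtain rfl : i = h := by omega
  have hdeg : (p ^ 2 - D * q ^ 2).natDegree = i * P.natDegree := by
    rw [natDegree_eq_of_associated hi, natDegree_pow]
  have hcop : IsCoprime p q := by
    refine isCoprime_of_irreducible_dvd ?_ ?_
    · rintro ⟨rfl, rfl⟩
      simp [hpq] at hx0
    -- A common prime factor divides the norm, so it is `P` up to a unit; then `P ∣ x` forces `𝔮 ∣ 𝔭
    -- ^ h`.
    · intro z hz hzp hzq
      have hzN : z ∣ p ^ 2 - D * q ^ 2 :=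
        dvd_sub (dvd_pow hzp two_ne_zero) (dvd_mul_of_dvd_right (dvd_pow hzq two_ne_zero) _)
      have hPz : Associated z P :=
        hz.associated_of_dvd hP (hz.prime.dvd_of_dvd_pow (hzN.trans hi.dvd))
      have hPx : algebraMap F[X] O P ∣ x := by
        rw [hpq]
        exact dvd_add ((algebraMap F[X] O).map_dvd (hPz.dvd'.trans hzp))
          (dvd_mul_of_dvd_left ((algebraMap F[X] O).map_dvd (hPz.dvd'.trans hzq)) _)
      have hq𝔭 : 𝔮 ∣ 𝔭 ^ i := by
        have : Ideal.span {algebraMap F[X] O P} ∣ Ideal.span {x} := by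
          rwa [Ideal.dvd_iff_le, Ideal.span_singleton_le_span_singleton]
        rw [hsplit, ← hx] at this
        exact (dvd_mul_left _ _).trans this
      have hp := Ideal.prime_of_isPrime h𝔭0 h𝔭
      have hq := Ideal.prime_of_isPrime h𝔮0 h𝔮
      exact hne (associated_iff_eq.1 (hq.associated_of_dvd hp (hq.dvd_of_dvd_pow hq𝔭))).symm
  refine ⟨p, q, hcop, ?_, hdeg⟩
  rintro rfl
  have hu : IsUnit p := isCoprime_zero_right.1 hcop
  rw [zero_pow two_ne_zero, mul_zero, sub_zero, natDegree_pow, natDegree_eq_zero_of_isUnit hu,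
    mul_zero] at hdeg
  exact (Nat.mul_pos hh hpos).ne hdeg

theorem isClassOrder_orderOf [Finite (ClassGroup O)] (I : nonZeroDivisors (Ideal O)) :
    IsClassOrder (I : Ideal O) (orderOf (ClassGroup.mk0 I)) := by
  have key : ∀ m : ℕ, ((I : Ideal O) ^ m).IsPrincipal ↔ ClassGroup.mk0 I ^ m = 1 := by
    intro m
    rw [← map_pow, ← ClassGroup.mk0_eq_one_iff (pow_mem I.2 m)]
    rfl
  refine ⟨⟨orderOf_pos _, (key _).2 (pow_orderOf_eq_one _)⟩, fun m hm => ?_⟩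
  exact orderOf_le_of_pow_eq_one hm.1 ((key m).1 hm.2)

/-- The classes of `𝔭` and `𝔮` are mutually inverse, as `𝔭 * 𝔮` is principal, so they have equal
order; no other prime contains `P`. -/
theorem exists_isClassOrder_of_split [Finite (ClassGroup O)] {P : F[X]}
    (hP0 : algebraMap F[X] O P ≠ 0) {𝔭 𝔮 : Ideal O} (h𝔭 : 𝔭.IsPrime) (h𝔮 : 𝔮.IsPrime)
    (hsplit : Ideal.span {algebraMap F[X] O P} = 𝔭 * 𝔮) :
    ∃ h : ℕ, h ∣ Nat.card (ClassGroup O) ∧ ∀ 𝔯 : Ideal O, 𝔯.IsPrime →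
      algebraMap F[X] O P ∈ 𝔯 → IsClassOrder 𝔯 h := by
  have hmul0 : 𝔭 * 𝔮 ≠ ⊥ := by
    rw [← hsplit, Ne, Ideal.span_singleton_eq_bot]
    exact hP0
  have h𝔭0 : 𝔭 ≠ ⊥ := by rintro rfl; simp at hmul0
  have h𝔮0 : 𝔮 ≠ ⊥ := by rintro rfl; simp at hmul0
  let I : nonZeroDivisors (Ideal O) := ⟨𝔭, mem_nonZeroDivisors_of_ne_zero h𝔭0⟩
  let J : nonZeroDivisors (Ideal O) := ⟨𝔮, mem_nonZeroDivisors_of_ne_zero h𝔮0⟩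
  have hIJ : ClassGroup.mk0 I = (ClassGroup.mk0 J)⁻¹ :=
    ClassGroup.mk0_eq_mk0_inv_iff.2 ⟨_, hP0, hsplit.symm⟩
  refine ⟨orderOf (ClassGroup.mk0 I), orderOf_dvd_natCard _, fun 𝔯 h𝔯 hmem => ?_⟩
  rcases IsPrime.eq_of_mul_le h𝔭 h𝔮 h𝔯 h𝔭0 h𝔮0
    (by rwa [← hsplit, Ideal.span_singleton_le_iff_mem]) with rfl | rfl
  · exact isClassOrder_orderOf I
  · rw [hIJ, orderOf_inv]
    exact isClassOrder_orderOf J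

end QuadraticOrder

/-! ### The integral closure of F[T] in F(T)(√D) -/

section QuadraticField

theorem isIntegral_sqrt {F K : Type*} [Field F] [Field K] [Algebra F[X] K] {D : F[X]} {θ : K}
    (hθ : θ ^ 2 = algebraMap F[X] K D) : IsIntegral F[X] θ :=
  ⟨X ^ 2 - C D, monic_X_pow_sub_C D two_ne_zero, by simp [hθ]⟩

variable {F : Type*} [Field F] {D : F[X]}
variable {K : Type*} [Field K] [Algebra F[X] K] [Algebra (RatFunc F) K]
  [IsScalarTower F[X] (RatFunc F) K] {θ : K}

theorem sqrt_notMem_range (hnsq : ¬ IsSquare D) (hθ : θ ^ 2 = algebraMap F[X] K D)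
    (c : RatFunc F) : algebraMap (RatFunc F) K c ≠ θ := by
  rintro rfl
  obtain ⟨r, rfl⟩ := IsIntegrallyClosed.isIntegral_iff.1
    ((isIntegral_algebraMap_iff (algebraMap (RatFunc F) K).injective).1 (isIntegral_sqrt hθ))
  refine hnsq ⟨r, FunctionField.algebraMap_injective F K ?_⟩
  rw [← hθ, ← IsScalarTower.algebraMap_apply, map_mul, sq]

theorem eq_zero_of_add_mul_sqrt_eq_zero (hnsq : ¬ IsSquare D)
    (hθ : θ ^ 2 = algebraMap F[X] K D) {a b : RatFunc F}
    (h : algebraMap (RatFunc F) K a + algebraMap (RatFunc F) K b * θ = 0) : b = 0 := by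
  by_contra hb
  have hbK : algebraMap (RatFunc F) K b ≠ 0 := by simpa using hb
  apply sqrt_notMem_range hnsq hθ (-a / b)
  rw [map_div₀, map_neg, div_eq_iff hbK]
  linear_combination -h

theorem exists_eq_add_mul_sqrt (hθ : θ ^ 2 = algebraMap F[X] K D)
    (hK : IntermediateField.adjoin (RatFunc F) {θ} = ⊤) (x : K) :
    ∃ a b : RatFunc F, x = algebraMap (RatFunc F) K a + algebraMap (RatFunc F) K b * θ := by
  have hint : IsIntegral (RatFunc F) θ := (isIntegral_sqrt hθ).tower_top
  have hx : x ∈ Algebra.adjoin (RatFunc F) {θ} := by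
    rw [← IntermediateField.adjoin_simple_toSubalgebra_of_isAlgebraic hint.isAlgebraic, hK]
    trivial
  have hD : θ ^ 2 = algebraMap (RatFunc F) K (algebraMap F[X] (RatFunc F) D) := by
    rw [hθ, IsScalarTower.algebraMap_apply F[X] (RatFunc F) K]
  induction hx using Algebra.adjoin_induction with
  | mem x hx => exact ⟨0, 1, by simp [Set.mem_singleton_iff.1 hx]⟩
  | algebraMap r => exact ⟨r, 0, by simp⟩
  | add x y _ _ hx hy =>
    obtain ⟨a, b, rfl⟩ := hx
    obtain ⟨c, e, rfl⟩ := hy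
    exact ⟨a + c, b + e, by simp only [map_add]; ring⟩
  | mul x y _ _ hx hy =>
    obtain ⟨a, b, rfl⟩ := hx
    obtain ⟨c, e, rfl⟩ := hy
    refine ⟨a * c + b * e * algebraMap F[X] (RatFunc F) D, a * e + b * c, ?_⟩
    simp only [map_add, map_mul, ← hD]
    ring

theorem isUnit_of_squarefree_mul_sq_eq (hsqf : Squarefree D) {u w r : F[X]} (huw : IsCoprime u w)
    (h : D * u ^ 2 = r * w ^ 2) : IsUnit w := by
  have h1 : w ^ 2 ∣ D * u ^ 2 := by
    rw [h]
    exact dvd_mul_left _ _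
  have h2 : w ^ 2 ∣ D := (huw.symm.pow (m := 2) (n := 2)).dvd_of_dvd_mul_right h1
  rw [sq] at h2
  exact hsqf w h2

theorem exists_algebraMap_eq_of_squarefree_mul_sq (hsqf : Squarefree D) {b : RatFunc F} {r : F[X]}
    (h : algebraMap F[X] (RatFunc F) D * b ^ 2 = algebraMap F[X] (RatFunc F) r) :
    ∃ q : F[X], algebraMap F[X] (RatFunc F) q = b := by
  obtain ⟨u, w, hw0, huw, rfl⟩ : ∃ u w : F[X], w ≠ 0 ∧ IsCoprime u w ∧
      algebraMap F[X] (RatFunc F) u / algebraMap F[X] (RatFunc F) w = b :=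
    ⟨b.num, b.denom, b.denom_ne_zero, b.isCoprime_num_denom, b.num_div_denom⟩
  have hw : algebraMap F[X] (RatFunc F) w ≠ 0 := by simpa using hw0
  have h1 : D * u ^ 2 = r * w ^ 2 := by
    apply IsFractionRing.injective F[X] (RatFunc F)
    rw [div_pow, ← mul_div_assoc, div_eq_iff (pow_ne_zero 2 hw)] at h
    rw [map_mul, map_mul, map_pow, map_pow, h]
  obtain ⟨z, hz⟩ := (isUnit_of_squarefree_mul_sq_eq hsqf huw h1).exists_right_inv
  refine ⟨u * z, ?_⟩
  rw [eq_div_iff hw, ← map_mul, mul_assoc, mul_comm z, hz, mul_one]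

/-- `1, √D` generate the integral closure of `F[T]` when `D` is square-free. -/
theorem exists_eq_add_mul_sqrt_of_isIntegral (h2 : (2 : F) ≠ 0) (hsqf : Squarefree D)
    (hnsq : ¬ IsSquare D) (hθ : θ ^ 2 = algebraMap F[X] K D)
    (hK : IntermediateField.adjoin (RatFunc F) {θ} = ⊤) {x : K} (hx : IsIntegral F[X] x) :
    ∃ p q : F[X], x = algebraMap F[X] K p + algebraMap F[X] K q * θ := by
  obtain ⟨a, b, rfl⟩ := exists_eq_add_mul_sqrt hθ hK x
  set x := algebraMap (RatFunc F) K a + algebraMap (RatFunc F) K b * θ with hxdef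
  have hD : θ ^ 2 = algebraMap (RatFunc F) K (algebraMap F[X] (RatFunc F) D) := by
    rw [hθ, IsScalarTower.algebraMap_apply F[X] (RatFunc F) K]
  by_cases hb : b = 0
  · have hxa : x = algebraMap (RatFunc F) K a := by simp [hxdef, hb]
    rw [hxa, isIntegral_algebraMap_iff (algebraMap (RatFunc F) K).injective] at hx
    obtain ⟨p, rfl⟩ := IsIntegrallyClosed.isIntegral_iff.1 hx
    exact ⟨p, 0, by simp [hxa, ← IsScalarTower.algebraMap_apply]⟩
  obtain ⟨e, he⟩ : ∃ e, e = a ^ 2 - algebraMap F[X] (RatFunc F) D * b ^ 2 := ⟨_, rfl⟩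
  set f : (RatFunc F)[X] := X ^ 2 + C (-2 * a) * X + C e with hf
  have hfdeg : f.natDegree = 2 := by
    rw [hf]
    compute_degree!
  have hfmonic : f.Monic := by
    rw [hf]
    monicity!
  have hfx : aeval x f = 0 := by
    simp only [hf, he, map_add, map_mul, map_pow, aeval_X, aeval_C, map_sub, ← hD, map_neg, map_ofNat,
      hxdef]
    ring
  have hxk : IsIntegral (RatFunc F) x := hx.tower_top
  have hrange : x ∉ (algebraMap (RatFunc F) K).range := by
    rintro ⟨c, hc⟩
    apply hb
    apply eq_zero_of_add_mul_sqrt_eq_zero hnsq hθ (a := a - c)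
    rw [map_sub, hc, hxdef]
    ring
  -- For `b ≠ 0` the minimal polynomial is `X ^ 2 - 2aX + (a ^ 2 - Db ^ 2)`, so integrality makes
  -- trace and norm polynomials.
  have hmin : minpoly (RatFunc F) x = f :=
    eq_of_dvd_of_natDegree_le_of_leadingCoeff (minpoly.dvd _ _ hfx)
      (hfdeg.trans_le ((minpoly.two_le_natDegree_iff hxk).2 hrange))
      ((minpoly.monic hxk).leadingCoeff.trans hfmonic.leadingCoeff.symm)
  rw [minpoly.isIntegrallyClosed_eq_field_fractions' (RatFunc F) hx] at hmin
  have hc1 : algebraMap F[X] (RatFunc F) ((minpoly F[X] x).coeff 1) = -2 * a := by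
    rw [← coeff_map, hmin, hf, coeff_add, coeff_add, coeff_C_mul_X, coeff_X_pow, coeff_C]
    simp
  have hc0 : algebraMap F[X] (RatFunc F) ((minpoly F[X] x).coeff 0) =
      a ^ 2 - algebraMap F[X] (RatFunc F) D * b ^ 2 := by
    rw [← coeff_map, hmin, hf, ← he]
    simp
  have h2' : (C (2⁻¹ : F) : F[X]) * 2 = 1 := by
    rw [← C_ofNat, ← C_mul, inv_mul_cancel₀ h2, C_1]
  have ha : algebraMap F[X] (RatFunc F) (-C (2⁻¹ : F) * (minpoly F[X] x).coeff 1) = a := by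
    have := congrArg (algebraMap F[X] (RatFunc F)) h2'
    rw [map_mul, map_one, map_ofNat] at this
    rw [map_mul, hc1, map_neg]
    linear_combination a * this
  -- Since `a` is a polynomial, so is `D * b ^ 2`; a square-free `D` cannot cancel a squared
  -- denominator of `b`.
  obtain ⟨q, hq⟩ := exists_algebraMap_eq_of_squarefree_mul_sq hsqf (b := b)
    (r := (-C (2⁻¹ : F) * (minpoly F[X] x).coeff 1) ^ 2 - (minpoly F[X] x).coeff 0) (by
      rw [map_sub, map_pow, ha, hc0]
      ring)
  refine ⟨-C (2⁻¹ : F) * (minpoly F[X] x).coeff 1, q, ?_⟩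
  rw [IsScalarTower.algebraMap_apply F[X] (RatFunc F) K, ha,
    IsScalarTower.algebraMap_apply F[X] (RatFunc F) K, hq]

theorem functionField_of_adjoin_sqrt (hθ : θ ^ 2 = algebraMap F[X] K D)
    (hK : IntermediateField.adjoin (RatFunc F) {θ} = ⊤) : FunctionField F K := by
  have hint : IsIntegral (RatFunc F) θ := (isIntegral_sqrt hθ).tower_top
  have := IntermediateField.adjoin.finiteDimensional hint
  rw [hK] at this
  exact IntermediateField.topEquiv.toLinearEquiv.finiteDimensional

/-- Separability enters the finiteness of the class group. -/
theorem isSeparable_of_adjoin_sqrt (h2 : (2 : F) ≠ 0) (hD : D ≠ 0)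
    (hθ : θ ^ 2 = algebraMap F[X] K D)
    (hK : IntermediateField.adjoin (RatFunc F) {θ} = ⊤) :
    Algebra.IsSeparable (RatFunc F) K := by
  have h2' : (2 : RatFunc F) ≠ 0 := by
    rw [← map_ofNat (algebraMap F (RatFunc F))]
    simpa using h2
  have hsep : IsSeparable (RatFunc F) θ := by
    have := separable_X_pow_sub_C (n := 2) (algebraMap F[X] (RatFunc F) D) (by simpa using h2')
      (by simpa using hD)
    refine this.of_dvd (minpoly.dvd _ _ ?_)
    simp [hθ, ← IsScalarTower.algebraMap_apply]
  have := (IntermediateField.isSeparable_adjoin_simple_iff_isSeparable (RatFunc F) K).2 hsep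
  rw [hK] at this
  exact Algebra.IsSeparable.of_algHom (RatFunc F) _
    (IntermediateField.topEquiv (F := RatFunc F) (E := K)).symm.toAlgHom

end QuadraticField

/-! ### The class number bound -/

theorem min'_insert_image_Ioo_le {v h : ℕ} (hpos : 0 < h) {x r : ℚ} {Q : ℕ → ℕ} (hv : Q v = 0)
    (hh : (∃ i, 1 ≤ i ∧ i ≤ v ∧ (h : ℚ) = (Q i : ℚ) / r) ∨ (h : ℚ) ≥ x) :
    (insert x ((Finset.Ioo 0 v).image fun i => (Q i : ℚ) / r)).min' (Finset.insert_nonempty _ _) ≤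
      h := by
  rcases hh with ⟨i, h1, h2, h3⟩ | h3
  · have hiv : i ≠ v := by
      rintro rfl
      rw [hv, Nat.cast_zero, zero_div] at h3
      exact hpos.ne' (by exact_mod_cast h3)
    rw [h3]
    apply Finset.min'_le
    exact Finset.mem_insert_of_mem (Finset.mem_image_of_mem _ (Finset.mem_Ioo.2 (by omega)))
  · exact (Finset.min'_le _ _ (Finset.mem_insert_self _ _)).trans h3

theorem theorem1 {F : Type*} [Field F] [Finite F] (hF : ringChar F ≠ 2)
    (D : F[X]) (d : ℕ) (hmonic : D.Monic) (hsqf : Squarefree D) (hnsq : ¬ IsSquare D)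
    (hdeg : D.natDegree = 2 * d)
    {K : Type*} [Field K] [Algebra F[X] K] [Algebra (RatFunc F) K]
    [IsScalarTower F[X] (RatFunc F) K]
    (θ : K) (hθ : θ ^ 2 = algebraMap F[X] K D)
    (hK : IntermediateField.adjoin (RatFunc F) {θ} = ⊤)
    (P : F[X]) (hP : Irreducible P)
    (hsplit : SplitsIn P (FunctionField.ringOfIntegers F K)) :
    ∃ (s : LaurentSeries F) (Pn Qn : ℕ → F[X]) (v : ℕ),
      IsMonicSqrt D s ∧ IsCompleteQuotientData s Pn Qn ∧ IsQuasiPeriod (partialQuotient s) v ∧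
      (∃ h₁ : ℕ, h₁ ∣ idealClassNumber F K ∧
        (∀ 𝔭 : Ideal (FunctionField.ringOfIntegers F K), 𝔭.IsPrime →
          algebraMap F[X] (FunctionField.ringOfIntegers F K) P ∈ 𝔭 → IsClassOrder 𝔭 h₁) ∧
        ((∃ i, 1 ≤ i ∧ i ≤ v ∧ (h₁ : ℚ) = ((Qn i).natDegree : ℚ) / (P.natDegree : ℚ)) ∨
          (h₁ : ℚ) ≥ (d : ℚ) / (P.natDegree : ℚ))) ∧
      (idealClassNumber F K : ℚ) ≥
        (insert ((d : ℚ) / (P.natDegree : ℚ))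
          ((Finset.Ioo 0 v).image fun i => ((Qn i).natDegree : ℚ) / (P.natDegree : ℚ))).min'
          (Finset.insert_nonempty _ _) := by
  have h2 : (2 : F) ≠ 0 := Ring.two_ne_zero hF
  have hd : 0 < d := by
    by_contra h
    have hD1 : D = 1 := hmonic.natDegree_eq_zero.1 (by omega)
    exact hnsq (hD1 ▸ IsSquare.one)
  obtain ⟨s, hs, hord⟩ := exists_isMonicSqrt h2 hmonic hdeg
  have hs2 := hs.1
  have hneg : s.order < 0 := by omega
  obtain ⟨v, hv⟩ := exists_isQuasiPeriod h2 hs2 hnsq hneg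
  have := Fintype.ofFinite F
  have := functionField_of_adjoin_sqrt hθ hK
  have := isSeparable_of_adjoin_sqrt h2 hmonic.ne_zero hθ hK
  have hfin : Finite (ClassGroup (FunctionField.ringOfIntegers F K)) := Finite.of_fintype _
  have hinj := FunctionField.ringOfIntegers.algebraMap_injective F K
  obtain ⟨𝔭, 𝔮, h𝔭, h𝔮, hne, hsplit⟩ := hsplit
  have hP0 : algebraMap F[X] (FunctionField.ringOfIntegers F K) P ≠ 0 := by
    rw [Ne, map_eq_zero_iff _ hinj]
    exact hP.ne_zero
  obtain ⟨h₁, hdvd, hcls⟩ := exists_isClassOrder_of_split hP0 h𝔭 h𝔮 hsplit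
  have hmem : algebraMap F[X] (FunctionField.ringOfIntegers F K) P ∈ 𝔭 := by
    rw [← Ideal.span_singleton_le_iff_mem, hsplit]
    exact Ideal.mul_le_left
  have hord𝔭 := (hcls 𝔭 h𝔭 hmem).1
  let Θ : FunctionField.ringOfIntegers F K := ⟨θ, isIntegral_sqrt hθ⟩
  have hindK : ∀ p q : F[X], algebraMap F[X] K p + algebraMap F[X] K q * θ = 0 → q = 0 := by
    intro p q h
    rw [IsScalarTower.algebraMap_apply F[X] (RatFunc F) K p,
      IsScalarTower.algebraMap_apply F[X] (RatFunc F) K q] at h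
    simpa using eq_zero_of_add_mul_sqrt_eq_zero hnsq hθ h
  obtain ⟨p, q, hpq, hq, hN⟩ := exists_coprime_natDegree_norm hinj (D := D) (Θ := Θ)
    (Subtype.ext hθ)
    (fun x => by
      obtain ⟨p, q, h⟩ := exists_eq_add_mul_sqrt_of_isIntegral h2 hsqf hnsq hθ hK x.2
      exact ⟨p, q, Subtype.ext h⟩)
    (fun p q h => hindK p q (congrArg Subtype.val h)) hP h𝔭 h𝔮 hne hsplit hord𝔭.1 hord𝔭.2
  have hdegP : (0 : ℚ) < P.natDegree := by exact_mod_cast hP.natDegree_pos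
  have hmain : (∃ i, 1 ≤ i ∧ i ≤ v ∧
      (h₁ : ℚ) = ((completeQuotientPair D s i).2.natDegree : ℚ) / (P.natDegree : ℚ)) ∨
      (h₁ : ℚ) ≥ (d : ℚ) / (P.natDegree : ℚ) := by
    -- `h₁ * deg P` is the degree of the norm of the generator, and `d` is the degree of √D.
    rcases lt_or_ge (h₁ * P.natDegree) d with hlt | hge
    · left
      obtain ⟨j, hj, hjN⟩ := exists_natDegree_norm_eq h2 hs2 hnsq hneg hpq hq (by omega)
      obtain ⟨i, hi, hiv, hij⟩ := hv.exists_natDegree_snd_eq h2 hs2 hnsq hneg hj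
      refine ⟨i, hi, hiv, ?_⟩
      rw [eq_div_iff hdegP.ne', hij, ← hjN, hN]
      push_cast
      rfl
    · right
      rw [ge_iff_le, div_le_iff₀ hdegP]
      exact_mod_cast hge
  refine ⟨s, fun n => (completeQuotientPair D s n).1, fun n => (completeQuotientPair D s n).2, v,
    hs, fun n => ?_, hv, ⟨h₁, hdvd, hcls, hmain⟩, ?_⟩
  · have h := completeQuotientPair_spec hs2 hnsq n
    exact ⟨h.1, h.2.2.2⟩
  · refine (min'_insert_image_Ioo_le hord𝔭.1
      (hv.natDegree_snd_eq_zero h2 hs2 hnsq hneg) hmain).trans ?_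
    exact_mod_cast Nat.le_of_dvd Nat.card_pos hdvd
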